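/- Let $H$ be a real Hilbert space. A set-valued operator $T:H\to 2^H$ is called $\mu$-monotone ($\mu\in\mathbb R$, of any sign) if $\langle x-y,u-v\rangle\ge\mu\|x-y\|^2$ for all $x,y\in H$, $u\in T(x)$, $v\in T(y)$, and maximally $\mu$-monotone if moreover no $\mu$-monotone operator has a graph strictly containing the graph of $T$. Write $\operatorname{zer}T=\{x\in H:0\in T(x)\}$ and $J_{\gamma T}=(\mathrm{Id}+\gamma T)^{-1}$. Let $F:H\to 2^H$ be maximally $\mu_F$-monotone and let $G:H\to H$ be $\mu_G$-monotone and Lipschitz continuous with constant $L>0$, where $\mu_F,\mu_G\in\mathbb R$ satisfy $\mu_F+\mu_G\ge 0$, and suppose that $\operatorname{zer}(F+G)\neq\emptyset$. Let $\gamma\in\left(0,\frac1{2L}\right)$ with $1+\gamma\mu_F>0$, and let $\theta_1,\theta_2\in\mathbb R$ satisfy $$0\le\theta_1<\tfrac13(1-2\gamma L),\qquad \frac{1}{3+4\theta_1}\,(3\theta_1-1+2\gamma L)<\theta_2\le 0 .$$ Let $(\lambda_k)_{k\ge1}\subset(0,1)$ satisfy $\lim_{k\to\infty}\lambda_k=0$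 and $\sum_{k=1}^\infty\lambda_k=\infty$. Then for all $w^*,u_{-1},u_0,u_1\in H$ the two-step inertial forward-reflected-anchored-backward iteration $$u_{k+1}=J_{\gamma F}\Big(\lambda_kw^*+(1-\lambda_k)\big(u_k+\theta_1(u_k-u_{k-1})+\theta_2(u_{k-1}-u_{k-2})\big)-\gamma Gu_k-\gamma(1-\lambda_k)(Gu_k-Gu_{k-1})\Big),\qquad k\ge1,$$ uniquely determines a sequence $(u_k)$, the metric projection $P_{\operatorname{zer}(F+G)}w^*$ exists (there is exactly one point of $\operatorname{zer}(F+G)$ nearest to $w^*$), and $(u_k)$ converges strongly to $P_{\operatorname{zer}(F+G)}w^*$. -/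

import Mathlib

open Filter Topology
open scoped NNReal

namespace FRAB

variable {H : Type*} [NormedAddCommGroup H] [InnerProductSpace ℝ H]

/-- The graph of a set-valued operator. -/
def graph (F : H → Set H) : Set (H × H) := {p | p.2 ∈ F p.1}

/-- `F` is `μ`-monotone: `⟪x - y, u - v⟫ ≥ μ ‖x - y‖ ^ 2` for all `u ∈ F x`, `v ∈ F y`.
The modulus `μ` may have any sign. -/
def IsMonotone (μ : ℝ) (F : H → Set H) : Prop :=
  ∀ x y u v : H, u ∈ F x → v ∈ F y → μ * ‖x - y‖ ^ 2 ≤ inner ℝ (x - y) (u - v)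

/-- `F` is maximally `μ`-monotone: it is `μ`-monotone and no `μ`-monotone operator has a graph
that strictly contains the graph of `F`. -/
def IsMaxMonotone (μ : ℝ) (F : H → Set H) : Prop :=
  IsMonotone μ F ∧ ¬ ∃ A : H → Set H, IsMonotone μ A ∧ graph F ⊂ graph A

/-- A single-valued operator regarded as a set-valued one. -/
def single (G : H → H) : H → Set H := fun x => {G x}

/-- The sum of a set-valued and a single-valued operator. -/
def opAdd (F : H → Set H) (G : H → H) : H → Set H := fun x => {y | ∃ v ∈ F x, v + G x = y}

/-- The set of zeros of a set-valued operator. -/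
def zer (F : H → Set H) : Set H := {x | (0 : H) ∈ F x}

/-- The (a priori set-valued) resolvent `(Id + γ F)⁻¹`: the points `p` with
`z ∈ p + γ F p`. -/
def resolvent (γ : ℝ) (F : H → Set H) (z : H) : Set H := {p | ∃ v ∈ F p, p + γ • v = z}

/-- The metric projection: the set of minimizers of the distance to `x` over `K`
is exactly `{p}`. -/
def IsMetricProjection (K : Set H) (x p : H) : Prop :=
  {q | q ∈ K ∧ ∀ z ∈ K, ‖q - x‖ ≤ ‖z - x‖} = {p}

/-- The sequence `s` is generated by the two-step inertial forward-reflected-anchored-backward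
algorithm from the initial points `a`, `b`, `c`. The iterates are indexed from `-1`, and
`s n` stands for the iterate number `n - 1`; so `s 0`, `s 1`, `s 2` are the initial points number
`-1`, `0`, `1`, and the step with parameter `lam k`, for `k = n + 1 ≥ 1`, computes `s (n + 3)`. -/
structure IsGenerated (F : H → Set H) (G : H → H) (γ θ₁ θ₂ : ℝ) (lam : ℕ → ℝ)
    (w a b c : H) (s : ℕ → H) : Prop where
  init_neg_one : s 0 = a
  init_zero : s 1 = b
  init_one : s 2 = c
  step : ∀ n : ℕ, s (n + 3) ∈ resolvent γ F
    (lam (n + 1) • w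
      + (1 - lam (n + 1)) •
          (s (n + 2) + θ₁ • (s (n + 2) - s (n + 1)) + θ₂ • (s (n + 1) - s n))
      - γ • G (s (n + 2))
      - (γ * (1 - lam (n + 1))) • (G (s (n + 2)) - G (s (n + 1))))

end FRAB

namespace FRAB

variable {H : Type*} [NormedAddCommGroup H] [InnerProductSpace ℝ H]

/-! Write `M = F + G`, which is monotone because the moduli add up to a nonnegative number. Minty's
theorem makes the iteration well defined and gives `M` an everywhere defined resolvent for one small
step size. Fixed points of contractions built from that resolvent form Browder's curve `t (w - z) ∈
M z`; it converges strongly to a zero `p` satisfying the variational inequality of the projection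
(`exists_projection_and_curve`).

For the iteration, each step exhibits a residual `e ∈ M (s (n + 3))`. Testing it against the zero
`p` makes a Lyapunov function `W`, which dominates `‖s (n + 2) - p‖² / 3`, satisfy `W (n+1) ≤ (1 -
l) W n + l (2⟪w - p, s (n+3) - p⟫ - ...) - (ε/2) S n`, where `S` sums the squares of three
consecutive increments (`lyapunov_step`). If `S` is not small, its term beats everything of order
`l`. If it is small, `e` is small, and monotonicity against one fixed point of the curve makes the
inner product almost nonpositive (`exists_inner_le_of_norm_le`). Either way `W (n+1) ≤ (1 - l) W n +
l δ` eventually, for every `δ > 0`, and divergence of `∑ l` forces `W → 0`. Neither weak cluster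
points nor subsequences are needed. -/

/-! ### Minty's theorem. -/

/-- The weighted double sum of `⟪x i - x j, u i - u j⟫` is nonnegative and equals twice the
difference of the two sides. -/
lemma inner_sum_le_sum_inner_of_monotone {ι : Type*} [Fintype ι] (x u : ι → H)
    (h : ∀ i j, 0 ≤ inner ℝ (x i - x j) (u i - u j)) {l : ι → ℝ}
    (hl : ∀ i, 0 ≤ l i) (hl1 : ∑ i, l i = 1) :
    inner ℝ (∑ i, l i • x i) (∑ i, l i • u i) ≤ ∑ i, l i * inner ℝ (x i) (u i) := by
  have h0 : 0 ≤ ∑ i, ∑ j, l i * l j * inner ℝ (x i - x j) (u i - u j) :=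
    Finset.sum_nonneg fun i _ => Finset.sum_nonneg fun j _ =>
      mul_nonneg (mul_nonneg (hl i) (hl j)) (h i j)
  have e : ∑ i, ∑ j, l i * l j * inner ℝ (x i - x j) (u i - u j)
      = 2 * (∑ i, l i * inner ℝ (x i) (u i))
        - 2 * inner ℝ (∑ i, l i • x i) (∑ i, l i • u i) := by
    have e1 : ∑ i, ∑ j, l i * l j * inner ℝ (x i) (u i) = ∑ i, l i * inner ℝ (x i) (u i) := by
      refine Finset.sum_congr rfl fun i _ => ?_
      rw [← Finset.sum_mul, ← Finset.mul_sum, hl1, mul_one]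
    have e2 : ∑ i, ∑ j, l i * l j * inner ℝ (x j) (u j) = ∑ i, l i * inner ℝ (x i) (u i) := by
      rw [Finset.sum_comm, ← e1]
      exact Finset.sum_congr rfl fun i _ => Finset.sum_congr rfl fun j _ => by ring
    have e3 : ∑ i, ∑ j, l i * l j * inner ℝ (x i) (u j)
        = inner ℝ (∑ i, l i • x i) (∑ i, l i • u i) := by
      rw [Finset.sum_comm]
      simp only [sum_inner, inner_sum, inner_smul_left, inner_smul_right, Finset.mul_sum]
      refine Finset.sum_congr rfl fun i _ => Finset.sum_congr rfl fun j _ => ?_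
      simp only [conj_trivial]; ring
    have e4 : ∑ i, ∑ j, l i * l j * inner ℝ (x j) (u i)
        = inner ℝ (∑ i, l i • x i) (∑ i, l i • u i) := by
      rw [Finset.sum_comm, ← e3]
      exact Finset.sum_congr rfl fun i _ => Finset.sum_congr rfl fun j _ => by ring
    have e5 : ∑ i, ∑ j, l i * l j * inner ℝ (x i - x j) (u i - u j)
        = ∑ i, ∑ j, l i * l j * inner ℝ (x i) (u i) + ∑ i, ∑ j, l i * l j * inner ℝ (x j) (u j)
          - ∑ i, ∑ j, l i * l j * inner ℝ (x i) (u j)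
          - ∑ i, ∑ j, l i * l j * inner ℝ (x j) (u i) := by
      simp only [← Finset.sum_add_distrib, ← Finset.sum_sub_distrib]
      refine Finset.sum_congr rfl fun i _ => Finset.sum_congr rfl fun j _ => ?_
      simp only [inner_sub_left, inner_sub_right]; ring
    rw [e5, e1, e2, e3, e4]; ring
  linarith

/-- With `b i = (x i - u i) / 2` and `c i = ⟪x i, u i⟫`, the claim reads `‖p‖² ≤ 2⟪p, b i⟫ + c i`.
Minimize `‖∑ l i • b i‖² + ∑ l i * c i` over the simplex and take `p = q`, the combination of the `b
i` at the minimizer: first-order optimality towards vertex `i` gives `2⟪q, b i⟫ + c i ≥ 2‖q‖² + m`,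
and the minimum `‖q‖² + m` is nonnegative. -/
lemma exists_inner_nonneg_of_finite_monotone {ι : Type*} [Fintype ι] [Nonempty ι] (x u : ι → H)
    (h : ∀ i j, 0 ≤ inner ℝ (x i - x j) (u i - u j)) :
    ∃ p : H, ∀ i, inner ℝ (p - x i) (p + u i) ≤ 0 := by
  classical
  set b : ι → H := fun i => (1 / 2 : ℝ) • (x i - u i) with hb
  set c : ι → ℝ := fun i => inner ℝ (x i) (u i) with hc
  have hcont : Continuous fun l : ι → ℝ => ‖∑ i, l i • b i‖ ^ 2 + ∑ i, l i * c i := by fun_prop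
  obtain ⟨l, hl, hmin⟩ := (isCompact_stdSimplex ℝ ι).exists_isMinOn
    (⟨_, single_mem_stdSimplex ℝ (Classical.arbitrary ι)⟩ : (stdSimplex ℝ ι).Nonempty)
    hcont.continuousOn
  set q : H := ∑ i, l i • b i with hq
  set m : ℝ := ∑ i, l i * c i with hm
  -- By the preceding lemma the value is at least `‖X - U‖² / 4 + ⟪X, U⟫ = ‖X + U‖² / 4`.
  have hpos : 0 ≤ ‖q‖ ^ 2 + m := by
    have h1 := inner_sum_le_sum_inner_of_monotone x u h hl.1 hl.2
    set X := ∑ i, l i • x i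
    set U := ∑ i, l i • u i
    have hqX : q = (1 / 2 : ℝ) • (X - U) := by
      simp only [hq, hb, X, U, ← Finset.sum_sub_distrib, Finset.smul_sum]
      refine Finset.sum_congr rfl fun i _ => ?_
      module
    have h2 : ‖X - U‖ ^ 2 = ‖X + U‖ ^ 2 - 4 * inner ℝ X U := by
      rw [norm_sub_sq_real, norm_add_sq_real]; ring
    have h3 : ‖q‖ ^ 2 = ‖X - U‖ ^ 2 / 4 := by
      rw [hqX, norm_smul]; norm_num; ring
    have : 0 ≤ ‖X + U‖ ^ 2 := by positivity
    linarith
  refine ⟨q, fun i => ?_⟩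
  have key : ∀ t : ℝ, 0 < t → t ≤ 1 →
      0 ≤ 2 * inner ℝ q (b i - q) + (c i - m) + t * ‖b i - q‖ ^ 2 := by
    intro t ht ht1
    have hmem : (1 - t) • l + t • (Pi.single i 1 : ι → ℝ) ∈ stdSimplex ℝ ι :=
      convex_stdSimplex ℝ ι hl (single_mem_stdSimplex ℝ i) (by linarith) ht.le (by ring)
    have h1 := hmin hmem
    have e1 : ∑ j, ((1 - t) • l + t • (Pi.single i 1 : ι → ℝ)) j • b j = q + t • (b i - q) := by
      simp only [Pi.add_apply, Pi.smul_apply, smul_eq_mul, add_smul, Finset.sum_add_distrib,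
        mul_smul, ← Finset.smul_sum, Pi.single_apply, ite_smul, one_smul, zero_smul,
        Finset.sum_ite_eq', Finset.mem_univ, if_true, ← hq]
      module
    have e2 : ∑ j, ((1 - t) • l + t • (Pi.single i 1 : ι → ℝ)) j * c j = m + t * (c i - m) := by
      simp only [Pi.add_apply, Pi.smul_apply, smul_eq_mul, add_mul, Finset.sum_add_distrib,
        mul_assoc, ← Finset.mul_sum, Pi.single_apply, ite_mul, one_mul, zero_mul,
        Finset.sum_ite_eq', Finset.mem_univ, if_true, ← hm]
      ring
    simp only [Set.mem_ofPred_eq, e1, e2, ← hq, ← hm] at h1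
    rw [norm_add_sq_real, inner_smul_right, norm_smul, mul_pow, Real.norm_eq_abs, sq_abs] at h1
    have : 0 ≤ t * (2 * inner ℝ q (b i - q) + (c i - m) + t * ‖b i - q‖ ^ 2) := by linarith
    exact nonneg_of_mul_nonneg_right this ht
  have hlim : 0 ≤ 2 * inner ℝ q (b i - q) + (c i - m) := by
    have ht : Tendsto (fun t : ℝ => 2 * inner ℝ q (b i - q) + (c i - m) + t * ‖b i - q‖ ^ 2)
        (𝓝[>] 0) (𝓝 (2 * inner ℝ q (b i - q) + (c i - m) + 0 * ‖b i - q‖ ^ 2)) :=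
      (Continuous.tendsto (by fun_prop) 0).mono_left nhdsWithin_le_nhds
    rw [zero_mul, add_zero] at ht
    refine ge_of_tendsto ht ?_
    filter_upwards [Ioc_mem_nhdsGT (zero_lt_one' ℝ)] with t ht using key t ht.1 ht.2
  have hbi : inner ℝ q (b i) = (inner ℝ q (x i) - inner ℝ q (u i)) / 2 := by
    simp only [hb, inner_smul_right, inner_sub_right]; ring
  simp only [inner_sub_right, hbi, real_inner_self_eq_norm_sq] at hlim
  simp only [inner_sub_left, inner_add_right, real_inner_self_eq_norm_sq]
  rw [real_inner_comm q (x i)]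
  simp only [hc] at hlim
  linarith

/-- Completing the square turns the condition on `p` into membership in a closed ball, which is
weakly compact. -/
lemma inner_sub_add_nonpos_iff (p x u : H) :
    inner ℝ (p - x) (p + u) ≤ 0 ↔ ‖p - (1 / 2 : ℝ) • (x - u)‖ ≤ ‖(1 / 2 : ℝ) • (x + u)‖ := by
  rw [← sq_le_sq₀ (norm_nonneg _) (norm_nonneg _), norm_sub_sq_real, norm_smul, norm_smul, mul_pow,
    mul_pow, norm_sub_sq_real, norm_add_sq_real, inner_smul_right, inner_sub_right, inner_sub_left,
    inner_add_right, inner_add_right, real_inner_self_eq_norm_sq, real_inner_comm p x]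
  norm_num
  constructor <;> intro h <;> linarith

/-- A monotone relation can be extended by a point `(p, -p)`. -/
lemma exists_inner_nonneg_of_monotone [CompleteSpace H] {ι : Type*} [Nonempty ι] (x u : ι → H)
    (h : ∀ i j, 0 ≤ inner ℝ (x i - x j) (u i - u j)) :
    ∃ p : H, ∀ i, inner ℝ (p - x i) (p + u i) ≤ 0 := by
  let T : H → StrongDual ℝ H := InnerProductSpace.toDual ℝ H
  let K : ι → Set (WeakDual ℝ H) := fun i =>
    WeakDual.toStrongDual ⁻¹' Metric.closedBall (T ((1 / 2 : ℝ) • (x i - u i)))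
      ‖(1 / 2 : ℝ) • (x i + u i)‖
  have hmem : ∀ p i, StrongDual.toWeakDual (T p) ∈ K i ↔ inner ℝ (p - x i) (p + u i) ≤ 0 := by
    intro p i
    rw [inner_sub_add_nonpos_iff]
    change dist (T p) (T _) ≤ _ ↔ _
    rw [(InnerProductSpace.toDual ℝ H).dist_map, dist_eq_norm]
  let i₀ : ι := Classical.arbitrary ι
  -- By Banach–Alaoglu the balls, moved to the dual, are weak-* compact, so the finite case
  -- suffices. The single ball `K i₀` supplies the compactness.
  have hne : (K i₀ ∩ ⋂ i, K i).Nonempty := by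
    refine (WeakDual.isCompact_closedBall _ _).inter_iInter_nonempty _
      (fun i => WeakDual.isClosed_closedBall _ _) fun s => ?_
    classical
    have : Nonempty (insert i₀ s : Finset ι) := ⟨⟨i₀, Finset.mem_insert_self i₀ s⟩⟩
    obtain ⟨p, hp⟩ := exists_inner_nonneg_of_finite_monotone
      (fun i : (insert i₀ s : Finset ι) => x i) (fun i => u i) fun i j => h i j
    refine ⟨StrongDual.toWeakDual (T p), (hmem p i₀).2 (hp ⟨i₀, by simp⟩), ?_⟩
    simp only [Set.mem_iInter]
    exact fun i hi => (hmem p i).2 (hp ⟨i, by simp [hi]⟩)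
  obtain ⟨f, -, hf⟩ := hne
  obtain ⟨p, hp⟩ := (InnerProductSpace.toDual ℝ H).surjective (WeakDual.toStrongDual f)
  refine ⟨p, fun i => (hmem p i).1 ?_⟩
  have : StrongDual.toWeakDual (T p) = f := hp
  rw [this]
  exact Set.mem_iInter.1 hf i

/-- Otherwise adjoining `(p, v)` would give a strictly larger `μ`-monotone graph. -/
lemma IsMaxMonotone.mem_of_forall {μ : ℝ} {F : H → Set H} (hF : IsMaxMonotone μ F) {p v : H}
    (h : ∀ x u, u ∈ F x → μ * ‖p - x‖ ^ 2 ≤ inner ℝ (p - x) (v - u)) : v ∈ F p := by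
  by_contra hv
  refine hF.2 ⟨fun x => {u | u ∈ F x ∨ (x = p ∧ u = v)}, ?_, ?_⟩
  · rintro x y u u' (hu | ⟨rfl, rfl⟩) (hu' | ⟨rfl, rfl⟩)
    · exact hF.1 x y u u' hu hu'
    · have := h x u hu
      rwa [norm_sub_rev, ← neg_sub x, ← neg_sub u, inner_neg_neg] at this
    · exact h y u' hu'
    · simp
  · refine ⟨fun q hq => Or.inl hq, fun hsub => hv ?_⟩
    exact hsub (show (p, v) ∈ graph _ from Or.inr ⟨rfl, rfl⟩)

/-- Minty's theorem for maximally `μ`-monotone operators. -/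
lemma IsMaxMonotone.resolvent_nonempty [CompleteSpace H] {μ γ : ℝ} {F : H → Set H}
    (hF : IsMaxMonotone μ F) (hγ : 0 < γ) (hm : 0 < 1 + γ * μ) (z : H) :
    (resolvent γ F z).Nonempty := by
  have hgn : Nonempty (graph F) := by
    by_contra hemp
    have hv : (0 : H) ∈ F 0 := hF.mem_of_forall fun x u hu => (hemp ⟨⟨(x, u), hu⟩⟩).elim
    exact hemp ⟨⟨(0, 0), hv⟩⟩
  set m := 1 + γ * μ with hmdef
  -- `F - μ Id` is monotone; it is scaled and translated so that the resulting inequality at `p`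
  -- says exactly that `(p, (z - p) / γ)` is `μ`-monotonically related to the graph of `F`.
  obtain ⟨p, hp⟩ := exists_inner_nonneg_of_monotone (fun i : graph F => i.1.1)
    (fun i : graph F => (γ / m) • (i.1.2 - μ • i.1.1) - (1 / m) • z) (by
      rintro ⟨⟨x, u⟩, hu⟩ ⟨⟨y, v⟩, hv⟩
      have h1 := hF.1 x y u v hu hv
      have e : (γ / m) • (u - μ • x) - (1 / m) • z - ((γ / m) • (v - μ • y) - (1 / m) • z)
          = (γ / m) • ((u - v) - μ • (x - y)) := by module
      simp only [e, inner_smul_right, inner_sub_right (x - y) (u - v),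
        real_inner_self_eq_norm_sq]
      have : 0 < γ / m := by positivity
      exact mul_nonneg this.le (by linarith))
  refine ⟨p, (1 / γ) • (z - p), hF.mem_of_forall fun x u hu => ?_, ?_⟩
  · have h1 := hp ⟨(x, u), hu⟩
    simp only at h1
    have e : p + ((γ / m) • (u - μ • x) - (1 / m) • z)
        = -((γ / m) • (((1 / γ) • (z - p) - u) - μ • (p - x))) := by
      have hγ' := hγ.ne'
      have : p = (1 / m) • p + (γ * μ / m) • p := by
        rw [← add_smul, ← add_div, ← hmdef, div_self hm.ne', one_smul]
      nth_rewrite 1 [this]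
      match_scalars <;> field_simp; ring
    rw [e, inner_neg_right, inner_smul_right, inner_sub_right, inner_smul_right,
      real_inner_self_eq_norm_sq] at h1
    have : 0 < γ / m := by positivity
    by_contra hlt
    push Not at hlt
    nlinarith
  · rw [smul_smul, mul_one_div_cancel hγ.ne', one_smul, add_sub_cancel]

/-! ### Resolvents, the regularization curve and the projection. -/

lemma IsMonotone.norm_sub_le_of_mem_resolvent {μ γ : ℝ} {F : H → Set H}
    (hF : IsMonotone μ F) (hγ : 0 ≤ γ) {z z' p p' : H}
    (hp : p ∈ resolvent γ F z) (hp' : p' ∈ resolvent γ F z') :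
    (1 + γ * μ) * ‖p - p'‖ ≤ ‖z - z'‖ := by
  obtain ⟨v, hv, rfl⟩ := hp
  obtain ⟨v', hv', rfl⟩ := hp'
  have h1 := mul_le_mul_of_nonneg_left (hF p p' v v' hv hv') hγ
  have h2 := real_inner_le_norm (p - p') ((p + γ • v) - (p' + γ • v'))
  have e : (p + γ • v) - (p' + γ • v') = (p - p') + γ • (v - v') := by module
  rw [e] at h2 ⊢
  rw [inner_add_right, inner_smul_right, real_inner_self_eq_norm_sq] at h2
  rcases (norm_nonneg (p - p')).eq_or_lt with h0 | h0
  · rw [← h0, mul_zero]; positivity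
  · refine le_of_mul_le_mul_left ?_ h0
    nlinarith

lemma IsMonotone.eq_of_mem_resolvent {μ γ : ℝ} {F : H → Set H}
    (hF : IsMonotone μ F) (hγ : 0 ≤ γ) (hm : 0 < 1 + γ * μ) {z p p' : H}
    (hp : p ∈ resolvent γ F z) (hp' : p' ∈ resolvent γ F z) : p = p' := by
  have h := hF.norm_sub_le_of_mem_resolvent hγ hp hp'
  rw [sub_self, norm_zero] at h
  have : ‖p - p'‖ ≤ 0 := nonpos_of_mul_nonpos_right h hm
  exact sub_eq_zero.1 (norm_le_zero_iff.1 this)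

lemma IsMonotone.opAdd {μF μG : ℝ} {F : H → Set H} {G : H → H} (hF : IsMonotone μF F)
    (hG : IsMonotone μG (single G)) : IsMonotone (μF + μG) (opAdd F G) := by
  rintro x y _ _ ⟨u, hu, rfl⟩ ⟨v, hv, rfl⟩
  have h1 := hF x y u v hu hv
  have h2 := hG x y (G x) (G y) rfl rfl
  rw [add_sub_add_comm, inner_add_right]
  linarith

lemma IsMonotone.mono {μ ν : ℝ} {F : H → Set H} (hF : IsMonotone μ F) (h : ν ≤ μ) :
    IsMonotone ν F := fun x y u v hu hv =>
  (mul_le_mul_of_nonneg_right h (sq_nonneg _)).trans (hF x y u v hu hv)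

/-- A strict Lipschitz estimate gives a fixed point. -/
lemma exists_fixedPoint_of_norm_sub_le {E : Type*} [NormedAddCommGroup E] [CompleteSpace E]
    {T : E → E} {k : ℝ} (hk0 : 0 ≤ k)
    (hk1 : k < 1) (hT : ∀ x y, ‖T x - T y‖ ≤ k * ‖x - y‖) : ∃ p, T p = p := by
  have hc : ContractingWith ⟨k, hk0⟩ T := by
    refine ⟨by exact_mod_cast hk1, LipschitzWith.of_dist_le_mul fun x y => ?_⟩
    rw [dist_eq_norm, dist_eq_norm]
    exact hT x y
  exact ⟨_, hc.fixedPoint_isFixedPt⟩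

/-- For small `c` the map `p ↦ J_{cF}(z - c G p)` is a contraction, and its fixed point lies in the
resolvent of the sum at `z`. One such `c` is all that is needed later; maximality of the sum is not.
-/
lemma exists_resolvent_opAdd_nonempty [CompleteSpace H] {μ : ℝ} {F : H → Set H} {G : H → H}
    {L : ℝ≥0} (hF : IsMaxMonotone μ F) (hG : LipschitzWith L G) :
    ∃ c : ℝ, 0 < c ∧ ∀ z, (resolvent c (opAdd F G) z).Nonempty := by
  have hL := L.coe_nonneg
  have hμ := abs_nonneg μ
  -- Any `c` with `c (L + |μ|) < 1` makes the contraction factor `c L / (1 + c μ)` less than `1`.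
  set c : ℝ := 1 / (2 * (L + |μ|) + 1) with hc
  have hc0 : 0 < c := by positivity
  have hc1 : c * (2 * (L + |μ|) + 1) = 1 := by
    rw [hc]; exact one_div_mul_cancel (by positivity)
  have hcμ : -(c * |μ|) ≤ c * μ := by
    have := mul_le_mul_of_nonneg_left (neg_abs_le μ) hc0.le
    linarith
  have hm : c * L < 1 + c * μ := by nlinarith
  have hm0 : 0 < 1 + c * μ := lt_of_le_of_lt (by positivity) hm
  refine ⟨c, hc0, fun z => ?_⟩
  choose f hf using hF.resolvent_nonempty hc0 hm0
  obtain ⟨p, hp⟩ := exists_fixedPoint_of_norm_sub_le (T := fun p => f (z - c • G p))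
    (k := c * L / (1 + c * μ)) (by positivity) ((div_lt_one hm0).2 hm) (by
      intro x y
      have h1 := hF.1.norm_sub_le_of_mem_resolvent hc0.le (hf (z - c • G x)) (hf (z - c • G y))
      rw [sub_sub_sub_cancel_left, ← smul_sub, norm_smul, Real.norm_of_nonneg hc0.le] at h1
      have h2 : ‖G y - G x‖ ≤ L * ‖x - y‖ := by
        rw [norm_sub_rev x y]; simpa [dist_eq_norm] using hG.dist_le_mul y x
      have h3 := mul_le_mul_of_nonneg_left h2 hc0.le
      rw [div_mul_eq_mul_div, le_div_iff₀ hm0]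
      linarith)
  obtain ⟨v, hv, hpv⟩ := hf (z - c • G p)
  have hp' : f _ = p := hp
  rw [hp'] at hv hpv
  refine ⟨p, v + G p, ⟨v, hv, rfl⟩, ?_⟩
  rw [smul_add, ← add_assoc, hpv, sub_add_cancel]

/-- The point is a fixed point of `p ↦ J(τ w + (1 - τ) p)`, a `(1 - τ)`-contraction because `J` is
nonexpansive. -/
lemma exists_smul_sub_mem [CompleteSpace H] {M : H → Set H} (hM : IsMonotone 0 M) {c : ℝ}
    (hc : 0 < c) (hres : ∀ z, (resolvent c M z).Nonempty) (w : H) {τ : ℝ} (hτ0 : 0 < τ)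
    (hτ1 : τ ≤ 1) : ∃ z, (τ / c) • (w - z) ∈ M z := by
  choose f hf using hres
  obtain ⟨p, hp⟩ := exists_fixedPoint_of_norm_sub_le (T := fun p => f (τ • w + (1 - τ) • p))
    (k := 1 - τ) (by linarith) (by linarith) (by
      intro x y
      have h1 := hM.norm_sub_le_of_mem_resolvent hc.le (hf (τ • w + (1 - τ) • x))
        (hf (τ • w + (1 - τ) • y))
      rwa [add_sub_add_left_eq_sub, ← smul_sub, norm_smul, Real.norm_of_nonneg (by linarith),
        mul_zero, add_zero, one_mul] at h1)
  obtain ⟨v, hv, hpv⟩ := hf (τ • w + (1 - τ) • p)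
  have hp' : f _ = p := hp
  rw [hp'] at hv hpv
  refine ⟨p, ?_⟩
  have : v = (τ / c) • (w - p) := by
    have h2 : c • v = τ • (w - p) := by
      rw [eq_sub_of_add_eq' hpv]; module
    rw [div_eq_inv_mul, mul_smul, ← h2, inv_smul_smul₀ hc.ne']
  rwa [← this]

/-- Convergence of the Browder regularization curve to the projection onto the set of zeros. -/
lemma exists_projection_and_curve [CompleteSpace H] {M : H → Set H} (hM : IsMonotone 0 M) {c : ℝ}
    (hc : 0 < c) (hres : ∀ z, (resolvent c M z).Nonempty) (hzer : (zer M).Nonempty) (w : H) :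
    ∃ p ∈ zer M, (∀ q ∈ zer M, inner ℝ (w - p) (q - p) ≤ 0) ∧
      ∃ (t : ℕ → ℝ) (z : ℕ → H), (∀ n, 0 < t n) ∧ (∀ n, t n • (w - z n) ∈ M (z n)) ∧
        Tendsto z atTop (𝓝 p) := by
  set τ : ℕ → ℝ := fun n => 1 / ((n : ℝ) + 1) with hτ
  have hτ0 : ∀ n, 0 < τ n := fun n => Nat.one_div_pos_of_nat
  have hτ1 : ∀ n, τ n ≤ 1 := fun n => by
    rw [hτ]; simp only
    rw [div_le_one (by positivity)]
    linarith [n.cast_nonneg (α := ℝ)]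
  have hτanti : StrictAnti τ := fun m n hmn => Nat.one_div_lt_one_div hmn
  have hτlim : Tendsto τ atTop (𝓝 0) := tendsto_one_div_add_atTop_nhds_zero_nat
  choose z hz using fun n => exists_smul_sub_mem hM hc hres w (hτ0 n) (hτ1 n)
  have ht0 : ∀ n, 0 < τ n / c := fun n => div_pos (hτ0 n) hc
  have hvar : ∀ n, ∀ q ∈ zer M, 0 ≤ inner ℝ (z n - q) (w - z n) := by
    intro n q hq
    have h1 := hM _ _ _ _ (hz n) hq
    rw [zero_mul, sub_zero, inner_smul_right] at h1
    exact nonneg_of_mul_nonneg_right h1 (ht0 n)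
  have hbdd : ∀ n, ∀ q ∈ zer M, ‖z n - w‖ ^ 2 ≤ ‖q - w‖ ^ 2 := by
    intro n q hq
    have h1 := hvar n q hq
    have h2 := norm_sub_sq_real (z n - w) (z n - q)
    have e : z n - w - (z n - q) = q - w := by abel
    rw [e, real_inner_comm, ← neg_sub w (z n), inner_neg_right, neg_sub] at h2
    linarith [sq_nonneg ‖z n - q‖]
  -- Monotonicity between `z m` and `z n`, with `τ` decreasing, gives `⟪x, y⟫ ≥ ‖y‖²`. Hence `‖z n -
  -- w‖²` is nondecreasing, and its convergence makes `z` Cauchy.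
  have hcau : ∀ n m, n ≤ m → ‖z m - z n‖ ^ 2 ≤ ‖z m - w‖ ^ 2 - ‖z n - w‖ ^ 2 := by
    intro n m hnm
    rcases hnm.eq_or_lt with rfl | hnm
    · simp
    have h1 := hM _ _ _ _ (hz m) (hz n)
    obtain ⟨x, hx⟩ : ∃ x, x = z m - w := ⟨_, rfl⟩
    obtain ⟨y, hy⟩ : ∃ y, y = z n - w := ⟨_, rfl⟩
    have ex : w - z m = -x := by rw [hx]; abel
    have ey : w - z n = -y := by rw [hy]; abel
    have exy : z m - z n = x - y := by rw [hx, hy]; abel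
    rw [ex, ey, exy, zero_mul] at h1
    rw [exy, ← hx, ← hy, norm_sub_sq_real]
    simp only [inner_sub_left, inner_sub_right, inner_smul_right, inner_neg_right,
      real_inner_self_eq_norm_sq] at h1
    rw [real_inner_comm x y] at h1
    have hts : τ m / c < τ n / c := div_lt_div_of_pos_right (hτanti hnm) hc
    have hm := ht0 m
    have h2 : 0 ≤ ‖x - y‖ ^ 2 := sq_nonneg _
    rw [norm_sub_sq_real] at h2
    have h3 : 0 ≤ (τ n / c - τ m / c) * (inner ℝ x y - ‖y‖ ^ 2) := by
      linarith [mul_nonneg hm.le h2]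
    have h4 := nonneg_of_mul_nonneg_right h3 (sub_pos.2 hts)
    linarith
  have hmono : Monotone fun n => ‖z n - w‖ ^ 2 := fun n m hnm => by
    have := hcau n m hnm
    simp only
    linarith [sq_nonneg ‖z m - z n‖]
  obtain ⟨q₀, hq₀⟩ := hzer
  have hconv := tendsto_atTop_ciSup hmono ⟨‖q₀ - w‖ ^ 2, by
    rintro _ ⟨n, rfl⟩; exact hbdd n q₀ hq₀⟩
  have hzc : CauchySeq z := by
    rw [Metric.cauchySeq_iff']
    intro ε hε
    obtain ⟨N, hN⟩ := Metric.cauchySeq_iff'.1 hconv.cauchySeq (ε ^ 2) (by positivity)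
    refine ⟨N, fun n hn => ?_⟩
    have h1 := (le_abs_self _).trans_lt (hN n hn)
    rw [dist_eq_norm]
    exact lt_of_pow_lt_pow_left₀ 2 hε.le ((hcau N n hn).trans_lt h1)
  obtain ⟨p, hp⟩ := cauchySeq_tendsto_of_complete hzc
  refine ⟨p, ?_, fun q hq => ?_, fun n => τ n / c, z, ht0, hz, hp⟩
  · choose f hf using hres
    -- Since `f` is nonexpansive, this relation passes to the limit as `f p = p`, which means `0 ∈ M
    -- p`.
    have hfz : ∀ n, f (z n + τ n • (w - z n)) = z n := fun n =>
      hM.eq_of_mem_resolvent hc.le (by simp) (hf _) ⟨_, hz n, by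
        rw [smul_smul, mul_div_cancel₀ _ hc.ne']⟩
    have hfc : Continuous f := by
      refine (LipschitzWith.of_dist_le_mul (K := 1) fun x y => ?_).continuous
      simpa [dist_eq_norm] using hM.norm_sub_le_of_mem_resolvent hc.le (hf x) (hf y)
    have h1 : Tendsto (fun n => f (z n + τ n • (w - z n))) atTop (𝓝 (f (p + (0 : ℝ) • (w - p)))) :=
      (hfc.tendsto _).comp (hp.add (hτlim.smul (tendsto_const_nhds.sub hp)))
    simp only [hfz, zero_smul, add_zero] at h1
    have h2 := tendsto_nhds_unique hp h1
    obtain ⟨v, hv, hpv⟩ := hf p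
    rw [← h2] at hv hpv
    have : v = 0 := by
      have h3 : c • v = 0 := by simpa using hpv
      exact (smul_eq_zero.1 h3).resolve_left hc.ne'
    rwa [this] at hv
  · have h1 : Tendsto (fun n => inner ℝ (z n - q) (w - z n)) atTop
        (𝓝 (inner ℝ (p - q) (w - p))) :=
      (hp.sub tendsto_const_nhds).inner (tendsto_const_nhds.sub hp)
    have h2 := ge_of_tendsto' h1 fun n => hvar n q hq
    rw [real_inner_comm, ← neg_sub p q, inner_neg_left]
    linarith

lemma isMetricProjection_of_inner_nonpos {K : Set H} {w p : H} (hp : p ∈ K)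
    (h : ∀ q ∈ K, inner ℝ (w - p) (q - p) ≤ 0) : IsMetricProjection K w p := by
  have key : ∀ q ∈ K, ‖p - w‖ ^ 2 + ‖q - p‖ ^ 2 ≤ ‖q - w‖ ^ 2 := by
    intro q hq
    have h1 := h q hq
    have h2 := norm_sub_sq_real (q - p) (w - p)
    rw [sub_sub_sub_cancel_right, real_inner_comm, norm_sub_rev w p] at h2
    linarith
  ext q
  simp only [Set.mem_ofPred_eq, Set.mem_singleton_iff]
  constructor
  · rintro ⟨hq, hmin⟩
    have h1 := key q hq
    have h2 := pow_le_pow_left₀ (norm_nonneg _) (hmin p hp) 2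
    have h3 : ‖q - p‖ ^ 2 = 0 := le_antisymm (by linarith) (sq_nonneg _)
    exact sub_eq_zero.1 (norm_eq_zero.1 (pow_eq_zero_iff two_ne_zero |>.1 h3))
  · rintro rfl
    refine ⟨hp, fun z hz => ?_⟩
    refine le_of_sq_le_sq ?_ (norm_nonneg _)
    have := key z hz
    linarith [sq_nonneg ‖z - q‖]

/-- Approximate zeros of `M` approximately satisfy the variational inequality of the projection. -/
lemma exists_inner_le_of_norm_le {M : H → Set H} (hM : IsMonotone 0 M) {w p : H} {t : ℕ → ℝ}
    {z : ℕ → H} (ht : ∀ n, 0 < t n) (hz : ∀ n, t n • (w - z n) ∈ M (z n))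
    (hlim : Tendsto z atTop (𝓝 p)) {R ε : ℝ} (hR : 0 ≤ R) (hε : 0 < ε) :
    ∃ η > 0, ∀ u e, e ∈ M u → ‖u - p‖ ≤ R → ‖e‖ ≤ η → inner ℝ (w - p) (u - p) ≤ ε := by
  have h1 : Tendsto (fun n => ‖z n - p‖ * (R + ‖w - z n‖)) atTop
      (𝓝 (‖p - p‖ * (R + ‖w - p‖))) :=
    (hlim.sub tendsto_const_nhds).norm.mul
      (tendsto_const_nhds.add (tendsto_const_nhds.sub hlim).norm)
  rw [sub_self, norm_zero, zero_mul] at h1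
  -- The curve point is fixed first, so that replacing `p` by `z n` costs at most `ε / 2`. Only then
  -- is `η` chosen, small relative to the positive number `t n`, which keeps the estimate uniform in
  -- `u`.
  obtain ⟨n, hn⟩ := (h1.eventually_lt_const (half_pos hε)).exists
  have hd : 0 < R + ‖z n - p‖ + 1 := by positivity
  refine ⟨t n * (ε / 2) / (R + ‖z n - p‖ + 1), by have := ht n; positivity,
    fun u e he hu hη => ?_⟩
  have h2 := hM _ _ _ _ he (hz n)
  rw [zero_mul, inner_sub_right, inner_smul_right] at h2
  have h3 : inner ℝ (u - z n) e ≤ t n * (ε / 2) := by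
    refine (real_inner_le_norm _ _).trans ?_
    have h4 : ‖u - z n‖ ≤ R + ‖z n - p‖ + 1 := by
      have := norm_sub_le (u - p) (z n - p)
      rw [sub_sub_sub_cancel_right] at this
      linarith
    calc ‖u - z n‖ * ‖e‖ ≤ (R + ‖z n - p‖ + 1) * (t n * (ε / 2) / (R + ‖z n - p‖ + 1)) :=
          mul_le_mul h4 hη (norm_nonneg _) hd.le
      _ = t n * (ε / 2) := mul_div_cancel₀ _ hd.ne'
  have h5 : inner ℝ (u - z n) (w - z n) ≤ ε / 2 :=
    le_of_mul_le_mul_left (by linarith) (ht n)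
  have h6 : inner ℝ (z n - p) (u - p) ≤ ‖z n - p‖ * R :=
    (real_inner_le_norm _ _).trans (mul_le_mul_of_nonneg_left hu (norm_nonneg _))
  have h7 := real_inner_le_norm (z n - p) (w - z n)
  have e1 : inner ℝ (w - p) (u - p)
      = inner ℝ (u - z n) (w - z n) + inner ℝ (z n - p) (u - p) + inner ℝ (z n - p) (w - z n) := by
    have a1 : w - p = (w - z n) + (z n - p) := by abel
    have a2 : u - z n = (u - p) - (z n - p) := by abel
    rw [a1, a2, inner_add_left (w - z n), inner_sub_left (u - p), real_inner_comm (w - z n) (u - p)]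
    ring
  rw [e1]
  linarith

/-! ### The Lyapunov inequality. -/

/-- The Lyapunov function of the iteration: `x₂, x₁, x₀` are consecutive errors, the most recent
one first, and `g` is the last increment of `γ G`. -/
noncomputable def lyapunov (θ₁ θ₂ A B : ℝ) (x₂ x₁ x₀ g : H) : ℝ :=
  ‖x₂‖ ^ 2 - θ₁ * ‖x₁‖ ^ 2 - θ₂ * ‖x₀‖ ^ 2 - 2 * inner ℝ x₂ g
    + A * ‖x₂ - x₁‖ ^ 2 + B * ‖x₁ - x₀‖ ^ 2

lemma two_mul_inner_le (x y : H) : 2 * inner ℝ x y ≤ ‖x‖ ^ 2 + ‖y‖ ^ 2 := by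
  have := norm_sub_sq_real x y
  nlinarith [sq_nonneg ‖x - y‖]

lemma neg_two_mul_inner_le (x y : H) : -(2 * inner ℝ x y) ≤ ‖x‖ ^ 2 + ‖y‖ ^ 2 := by
  have := norm_add_sq_real x y
  nlinarith [sq_nonneg ‖x + y‖]

lemma abs_two_mul_inner_le {κ : ℝ} {x y g : H} (hκ : 0 ≤ κ) (hg : ‖g‖ ≤ κ * ‖y‖) :
    |2 * inner ℝ x g| ≤ κ * (‖x‖ ^ 2 + ‖y‖ ^ 2) := by
  have h1 := abs_real_inner_le_norm x g
  have h2 := mul_le_mul_of_nonneg_left hg (norm_nonneg x)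
  rw [abs_mul, abs_of_pos (zero_lt_two' ℝ)]
  nlinarith [mul_nonneg hκ (sq_nonneg (‖x‖ - ‖y‖))]

/-- `‖x₁‖² ≤ 2‖x₂‖² + 2‖x₂ - x₁‖²` costs `2θ₁` on each square and the cross term costs `κ` on each.
`A` pays for the increment, and `1 - 2θ₁ - κ ≥ 1/3` remains on `‖x₂‖²`. -/
lemma lyapunov_ge {θ₁ θ₂ κ A B : ℝ} {x₂ x₁ x₀ g : H} (hθ₁ : 0 ≤ θ₁) (hκ : 0 ≤ κ)
    (hθκ : 3 * θ₁ + 2 * κ ≤ 1) (hθ₂ : θ₂ ≤ 0) (hA : 2 * θ₁ + κ ≤ A) (hB : 0 ≤ B)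
    (hg : ‖g‖ ≤ κ * ‖x₂ - x₁‖) :
    ‖x₂‖ ^ 2 / 3 ≤ lyapunov θ₁ θ₂ A B x₂ x₁ x₀ g := by
  have h1 := (abs_le.1 (abs_two_mul_inner_le (x := x₂) hκ hg)).2
  have h2 : ‖x₁‖ ^ 2 ≤ 2 * ‖x₂‖ ^ 2 + 2 * ‖x₂ - x₁‖ ^ 2 := by
    have := parallelogram_law_with_norm ℝ x₂ (x₂ - x₁)
    have e : x₂ - (x₂ - x₁) = x₁ := by abel
    rw [e] at this
    nlinarith [sq_nonneg ‖x₂ + (x₂ - x₁)‖]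
  have h3 := mul_le_mul_of_nonneg_left h2 hθ₁
  have h4 : 0 ≤ -θ₂ * ‖x₀‖ ^ 2 := mul_nonneg (by linarith) (sq_nonneg _)
  have h5 : 0 ≤ B * ‖x₁ - x₀‖ ^ 2 := by positivity
  have h6 := mul_le_mul_of_nonneg_right hA (sq_nonneg ‖x₂ - x₁‖)
  have h7 : 0 ≤ (2 / 3 - 2 * θ₁ - κ) * ‖x₂‖ ^ 2 := mul_nonneg (by linarith) (sq_nonneg _)
  unfold lyapunov
  linarith

/-- Polarization of twice `h` makes the errors telescope, and Young's inequality bounds the products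
of increments. For `l = 0`, the values of `A` and `B` leave margins `2ε`, `ε`, `ε` on the three
squared increments, from the newest to the oldest. Keeping `ε / 2` of each, the rest pays for the
corrections of order `l`, whence `6 * l ≤ ε`. -/
lemma lyapunov_step {θ₁ θ₂ κ ε A B l : ℝ} {x₃ x₂ x₁ x₀ g₃ g₂ q : H}
    (hθ₁ : 0 ≤ θ₁) (hκ : 0 ≤ κ) (hθ₂ : θ₂ ≤ 0) (hε : 0 < ε)
    (hsum : 4 * ε = 1 - 3 * θ₁ - 2 * κ + 3 * θ₂)
    (hA : A = 2 * θ₁ + κ - 2 * θ₂ + 2 * ε) (hB : B = -θ₂ + ε)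
    (hl : 0 ≤ l) (hlε : 6 * l ≤ ε)
    (hg₂ : ‖g₂‖ ≤ κ * ‖x₂ - x₁‖)
    (h : 0 ≤ inner ℝ x₃ (l • q + (1 - l) • (x₂ + θ₁ • (x₂ - x₁) + θ₂ • (x₁ - x₀)) - x₃
      + g₃ - (1 - l) • g₂)) :
    lyapunov θ₁ θ₂ A B x₃ x₂ x₁ g₃ ≤ (1 - l) * lyapunov θ₁ θ₂ A B x₂ x₁ x₀ g₂
      + l * (2 * inner ℝ q x₃ - ‖x₃‖ ^ 2 / 3)
      - ε / 2 * (‖x₃ - x₂‖ ^ 2 + ‖x₂ - x₁‖ ^ 2 + ‖x₁ - x₀‖ ^ 2) := by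
  obtain ⟨d₃, rfl⟩ : ∃ d, x₂ = x₃ - d := ⟨x₃ - x₂, by abel⟩
  obtain ⟨d₂, rfl⟩ : ∃ d, x₁ = x₃ - d₃ - d := ⟨x₃ - d₃ - x₁, by abel⟩
  obtain ⟨d₁, rfl⟩ : ∃ d, x₀ = x₃ - d₃ - d₂ - d := ⟨x₃ - d₃ - d₂ - x₀, by abel⟩
  simp only [sub_sub_cancel] at hg₂ h ⊢
  have hl1 : 0 ≤ 1 - l := by linarith
  have b₁ := mul_le_mul_of_nonneg_left (two_mul_inner_le d₃ d₂) hθ₁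
  have b₂ := mul_le_mul_of_nonneg_left (neg_two_mul_inner_le d₂ d₁) (neg_nonneg.2 hθ₂)
  have b₃ := mul_le_mul_of_nonneg_left (neg_two_mul_inner_le d₃ d₁) (neg_nonneg.2 hθ₂)
  have b₄ := neg_le_of_abs_le (abs_two_mul_inner_le (x := d₃) hκ hg₂)
  -- The anchoring leaves `-l‖x₃‖²` and the unfavourable `-l θ₂ ‖x₁‖²`. As `-θ₂ ≤ 1/3`, this bound
  -- consumes at most two thirds of the former; hence the `‖x₃‖² / 3` in the conclusion and the `4 *
  -- l / 3` below.
  have b₅ : ‖x₃ - d₃ - d₂‖ ^ 2 ≤ 2 * ‖x₃‖ ^ 2 + 4 * ‖d₃‖ ^ 2 + 4 * ‖d₂‖ ^ 2 := by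
    have e := neg_two_mul_inner_le x₃ (d₃ + d₂)
    have e' := two_mul_inner_le d₃ d₂
    rw [sub_sub, norm_sub_sq_real]
    rw [norm_add_sq_real] at e ⊢
    linarith
  have hx₂ : 0 ≤ l * θ₁ * ‖x₃ - d₃‖ ^ 2 := by positivity
  have hx₁ := mul_le_mul_of_nonneg_left b₅ (mul_nonneg hl (neg_nonneg.2 hθ₂))
  have hc : 0 ≤ l * (1 / 3 + θ₂) * (2 * ‖x₃‖ ^ 2 + 4 * ‖d₃‖ ^ 2 + 4 * ‖d₂‖ ^ 2) :=
    mul_nonneg (mul_nonneg hl (by linarith)) (by positivity)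
  have hb := mul_le_mul_of_nonneg_left (add_le_add (add_le_add b₁ b₂) (add_le_add b₃ b₄)) hl1
  have c₃ : 0 ≤ ((1 - l) * (A + 2 * ε) - A - 4 * l / 3 - ε / 2) * ‖d₃‖ ^ 2 := by
    refine mul_nonneg ?_ (sq_nonneg _)
    have : l * (A + 2 * ε) ≤ l * 1 := mul_le_mul_of_nonneg_left (by linarith) hl
    linarith
  have c₂ : 0 ≤ ((1 - l) * (B + ε) - B - 4 * l / 3 - ε / 2) * ‖d₂‖ ^ 2 := by
    refine mul_nonneg ?_ (sq_nonneg _)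
    have : l * (B + ε) ≤ l * 1 := mul_le_mul_of_nonneg_left (by linarith) hl
    linarith
  have c₁ : 0 ≤ ((1 - l) * ε - ε / 2) * ‖d₁‖ ^ 2 := by
    refine mul_nonneg ?_ (sq_nonneg _)
    nlinarith
  unfold lyapunov
  simp only [sub_sub_cancel]
  simp only [inner_add_right, inner_sub_right, inner_sub_left, inner_smul_right,
    norm_sub_sq_real, real_inner_self_eq_norm_sq] at *
  rw [real_inner_comm x₃ q]
  obtain rfl : ε = (1 - 3 * θ₁ - 2 * κ + 3 * θ₂) / 4 := by linarith
  subst hA hB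
  linarith

/-! ### Well-definedness and strong convergence of the iteration. -/

lemma existsUnique_seq_of_three_step {X : Type*} (Φ : ℕ → X → X → X → X) (a b c : X) :
    ∃! s : ℕ → X, s 0 = a ∧ s 1 = b ∧ s 2 = c ∧
      ∀ n, s (n + 3) = Φ n (s n) (s (n + 1)) (s (n + 2)) := by
  let r : ℕ → X × X × X := fun n =>
    Nat.rec (a, b, c) (fun n q => (q.2.1, q.2.2, Φ n q.1 q.2.1 q.2.2)) n
  refine ⟨fun n => (r n).1, ⟨rfl, rfl, rfl, fun n => rfl⟩, ?_⟩
  rintro s ⟨h0, h1, h2, h3⟩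
  have key : ∀ n, s n = (r n).1 ∧ s (n + 1) = (r n).2.1 ∧ s (n + 2) = (r n).2.2 := by
    intro n
    induction n with
    | zero => exact ⟨h0, h1, h2⟩
    | succ n ih =>
      refine ⟨ih.2.1, ih.2.2, ?_⟩
      have : s (n + 1 + 2) = Φ n (s n) (s (n + 1)) (s (n + 2)) := h3 n
      rw [this, ih.1, ih.2.1, ih.2.2]
  exact funext fun n => (key n).1

/-- The iteration is well defined: the resolvent steps determine exactly one sequence. -/
lemma existsUnique_isGenerated [CompleteSpace H] {F : H → Set H} {μ γ : ℝ}
    (hF : IsMaxMonotone μ F) (hγ : 0 < γ) (hm : 0 < 1 + γ * μ) (G : H → H) (θ₁ θ₂ : ℝ)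
    (lam : ℕ → ℝ) (w a b c : H) : ∃! s : ℕ → H, IsGenerated F G γ θ₁ θ₂ lam w a b c s := by
  choose J hJ using hF.resolvent_nonempty hγ hm
  have hJ' : ∀ z p, p ∈ resolvent γ F z ↔ p = J z := fun z p =>
    ⟨fun hp => hF.1.eq_of_mem_resolvent hγ.le hm hp (hJ z), fun hp => hp ▸ hJ z⟩
  obtain ⟨s, ⟨h0, h1, h2, h3⟩, huniq⟩ := existsUnique_seq_of_three_step (fun n x y z =>
    J (lam (n + 1) • w + (1 - lam (n + 1)) • (z + θ₁ • (z - y) + θ₂ • (y - x))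
      - γ • G z - (γ * (1 - lam (n + 1))) • (G z - G y))) a b c
  refine ⟨s, ⟨h0, h1, h2, fun n => (hJ' _ _).2 (h3 n)⟩, fun s' hs' => huniq s' ?_⟩
  exact ⟨hs'.init_neg_one, hs'.init_zero, hs'.init_one, fun n => (hJ' _ _).1 (hs'.step n)⟩

/-- The residual serves twice: tested against a zero it gives the Lyapunov inequality, and its norm
measures how close the iterate is to being a zero. -/
lemma IsGenerated.exists_mem_opAdd {F : H → Set H} {G : H → H} {γ θ₁ θ₂ : ℝ} {lam : ℕ → ℝ}
    {w a b c : H} {s : ℕ → H} (hs : IsGenerated F G γ θ₁ θ₂ lam w a b c s) (n : ℕ) :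
    ∃ e ∈ opAdd F G (s (n + 3)), γ • e = lam (n + 1) • w
      + (1 - lam (n + 1)) • (s (n + 2) + θ₁ • (s (n + 2) - s (n + 1)) + θ₂ • (s (n + 1) - s n))
      - s (n + 3) + γ • (G (s (n + 3)) - G (s (n + 2)))
      - (1 - lam (n + 1)) • γ • (G (s (n + 2)) - G (s (n + 1))) := by
  obtain ⟨v, hv, h⟩ := hs.step n
  refine ⟨v + G (s (n + 3)), ⟨v, hv, rfl⟩, ?_⟩
  rw [smul_add, eq_sub_of_add_eq' h]
  module

/-- The excess of `W` over `ε / 2` is multiplied by at most `1 - l n ≤ exp (-l n)` at each step, and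
the product of these factors vanishes because `∑ l` diverges. -/
lemma tendsto_zero_of_eventually_le {W l : ℕ → ℝ} (hW : ∀ n, 0 ≤ W n)
    (hl : ∀ n, l n < 1)
    (hsum : Tendsto (fun n => ∑ i ∈ Finset.range n, l i) atTop atTop)
    (h : ∀ ε > 0, ∀ᶠ n in atTop, W (n + 1) ≤ (1 - l n) * W n + l n * ε) :
    Tendsto W atTop (𝓝 0) := by
  refine tendsto_order.2 ⟨fun x hx => Eventually.of_forall fun n => hx.trans_le (hW n),
    fun ε hε => ?_⟩
  obtain ⟨N, hN⟩ := eventually_atTop.1 (h (ε / 2) (half_pos hε))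
  set S : ℕ → ℝ := fun n => ∑ i ∈ Finset.range n, l i with hS
  have key : ∀ n, N ≤ n → W n - ε / 2 ≤ |W N - ε / 2| * Real.exp (S N - S n) := by
    intro n hn
    induction n, hn using Nat.le_induction with
    | base => simp [le_abs_self]
    | succ n hn ih =>
      have h1 : S (n + 1) = S n + l n := Finset.sum_range_succ _ _
      have h2 : 0 < 1 - l n := sub_pos.2 (hl n)
      have h3 : 1 - l n ≤ Real.exp (-l n) := by
        have := Real.add_one_le_exp (-l n); linarith
      calc W (n + 1) - ε / 2 ≤ (1 - l n) * (W n - ε / 2) := by linarith [hN n hn]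
        _ ≤ (1 - l n) * (|W N - ε / 2| * Real.exp (S N - S n)) :=
          mul_le_mul_of_nonneg_left ih h2.le
        _ ≤ Real.exp (-l n) * (|W N - ε / 2| * Real.exp (S N - S n)) :=
          mul_le_mul_of_nonneg_right h3 (by positivity)
        _ = |W N - ε / 2| * Real.exp (S N - S (n + 1)) := by
          rw [mul_left_comm, ← Real.exp_add, h1]; congr 2; ring
  have hlim : Tendsto (fun n => |W N - ε / 2| * Real.exp (S N - S n)) atTop
      (𝓝 (|W N - ε / 2| * 0)) := by
    refine tendsto_const_nhds.mul (Real.tendsto_exp_atBot.comp ?_)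
    simp only [sub_eq_add_neg]
    exact tendsto_atBot_add_const_left _ _ (tendsto_neg_atTop_atBot.comp hsum)
  rw [mul_zero] at hlim
  filter_upwards [hlim.eventually_lt_const (half_pos hε), eventually_ge_atTop N] with n h1 h2
  linarith [key n h2]

/-- Bounds `γ` times the residual: what does not carry the factor `l` is a sum of four terms, each
controlled by increments since `θ₁ - θ₂ ≤ 1` and `κ ≤ 1`. -/
lemma norm_step_le {θ₁ θ₂ κ l R σ : ℝ} {x₃ x₂ x₁ x₀ g₃ g₂ q : H} (hθ₁ : 0 ≤ θ₁) (hκ : 0 ≤ κ)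
    (hθ₂ : θ₂ ≤ 0) (hθ : 0 ≤ 1 - 3 * θ₁ - 2 * κ + 3 * θ₂) (hl : 0 ≤ l) (hl1 : l ≤ 1)
    (r₀ : ‖x₀‖ ≤ R) (r₁ : ‖x₁‖ ≤ R) (r₂ : ‖x₂‖ ≤ R)
    (d₃ : ‖x₃ - x₂‖ ≤ σ) (d₂ : ‖x₂ - x₁‖ ≤ σ) (d₁ : ‖x₁ - x₀‖ ≤ σ)
    (hg₃ : ‖g₃‖ ≤ κ * ‖x₃ - x₂‖) (hg₂ : ‖g₂‖ ≤ κ * ‖x₂ - x₁‖) :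
    ‖l • q + (1 - l) • (x₂ + θ₁ • (x₂ - x₁) + θ₂ • (x₁ - x₀)) - x₃ + g₃ - (1 - l) • g₂‖
      ≤ l * (‖q‖ + 5 * R) + 4 * σ := by
  have hmul : ∀ {k : ℝ} {v : H} {r : ℝ}, 0 ≤ k → k ≤ 1 → ‖v‖ ≤ r → ‖k • v‖ ≤ r := by
    intro k v r hk0 hk1 hv
    rw [norm_smul, Real.norm_of_nonneg hk0]
    exact (mul_le_of_le_one_left (norm_nonneg _) hk1).trans hv
  have hin : ∀ {r : ℝ}, ‖x₂ - x₁‖ ≤ r → ‖x₁ - x₀‖ ≤ r →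
      ‖θ₁ • (x₂ - x₁) + θ₂ • (x₁ - x₀)‖ ≤ r := by
    intro r h₂ h₁
    refine (norm_add_le _ _).trans ?_
    rw [norm_smul, norm_smul, Real.norm_of_nonneg hθ₁, Real.norm_of_nonpos hθ₂]
    have e₂ := mul_le_mul_of_nonneg_left h₂ hθ₁
    have e₁ := mul_le_mul_of_nonneg_left h₁ (neg_nonneg.2 hθ₂)
    have e₀ : (θ₁ + -θ₂) * r ≤ 1 * r :=
      mul_le_mul_of_nonneg_right (by linarith) ((norm_nonneg _).trans h₁)
    linarith
  have hin₁ := hin d₂ d₁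
  have hin₂ : ‖θ₁ • (x₂ - x₁) + θ₂ • (x₁ - x₀)‖ ≤ 2 * R :=
    hin ((norm_sub_le _ _).trans (by linarith)) ((norm_sub_le _ _).trans (by linarith))
  set v := θ₁ • (x₂ - x₁) + θ₂ • (x₁ - x₀) with hv
  have e : l • q + (1 - l) • (x₂ + θ₁ • (x₂ - x₁) + θ₂ • (x₁ - x₀)) - x₃ + g₃ - (1 - l) • g₂
      = l • (q - (x₂ + v)) + (v - (x₃ - x₂) + g₃ - (1 - l) • g₂) := by
    rw [hv]; module
  have hR : 0 ≤ R := (norm_nonneg _).trans r₀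
  have n₁ : ‖l • (q - (x₂ + v))‖ ≤ l * (‖q‖ + 5 * R) := by
    rw [norm_smul, Real.norm_of_nonneg hl]
    refine mul_le_mul_of_nonneg_left ?_ hl
    linarith [norm_sub_le q (x₂ + v), norm_add_le x₂ v]
  have hκ1 : κ ≤ 1 := by linarith
  have n₃ : ‖g₃‖ ≤ σ := hg₃.trans ((mul_le_of_le_one_left (norm_nonneg _) hκ1).trans d₃)
  have n₂ : ‖(1 - l) • g₂‖ ≤ σ := hmul (sub_nonneg.2 hl1) (by linarith)
    (hg₂.trans ((mul_le_of_le_one_left (norm_nonneg _) hκ1).trans d₂))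
  rw [e]
  linarith [norm_add_le (l • (q - (x₂ + v))) (v - (x₃ - x₂) + g₃ - (1 - l) • g₂),
    norm_sub_le (v - (x₃ - x₂) + g₃) ((1 - l) • g₂), norm_add_le (v - (x₃ - x₂)) g₃,
    norm_sub_le v (x₃ - x₂)]

/-- Strong convergence of the iteration to a zero characterized as the projection of `w`. -/
lemma IsGenerated.tendsto {F : H → Set H} {G : H → H} {μF μG : ℝ} {L : ℝ≥0} {γ θ₁ θ₂ : ℝ}
    {lam : ℕ → ℝ} (hF : IsMonotone μF F) (hG : IsMonotone μG (single G))
    (hGL : LipschitzWith L G) (hμ : 0 ≤ μF + μG) (hγ : 0 < γ) (hθ₁ : 0 ≤ θ₁) (hθ₂ : θ₂ ≤ 0)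
    (hθ : 0 < 1 - 3 * θ₁ - 2 * (γ * L) + 3 * θ₂)
    (hlam : ∀ n, 0 < lam (n + 1) ∧ lam (n + 1) < 1) (hlim : Tendsto lam atTop (𝓝 0))
    (hsum : Tendsto (fun n => ∑ i ∈ Finset.range n, lam (i + 1)) atTop atTop)
    {w a b c p : H} {t : ℕ → ℝ} {z : ℕ → H} (hp : p ∈ zer (opAdd F G)) (ht : ∀ n, 0 < t n)
    (hz : ∀ n, t n • (w - z n) ∈ opAdd F G (z n)) (hzp : Tendsto z atTop (𝓝 p))
    {s : ℕ → H} (hs : IsGenerated F G γ θ₁ θ₂ lam w a b c s) : Tendsto s atTop (𝓝 p) := by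
  set M := opAdd F G with hMdef
  have hM : IsMonotone 0 M := (hF.opAdd hG).mono hμ
  set κ : ℝ := γ * L with hκdef
  have hκ : 0 ≤ κ := mul_nonneg hγ.le L.coe_nonneg
  obtain ⟨ε, hε⟩ : ∃ ε, 4 * ε = 1 - 3 * θ₁ - 2 * κ + 3 * θ₂ :=
    ⟨(1 - 3 * θ₁ - 2 * κ + 3 * θ₂) / 4, by ring⟩
  have hε0 : 0 < ε := by linarith
  obtain ⟨A, hA⟩ : ∃ A, A = 2 * θ₁ + κ - 2 * θ₂ + 2 * ε := ⟨_, rfl⟩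
  obtain ⟨B, hB⟩ : ∃ B, B = -θ₂ + ε := ⟨_, rfl⟩
  set x : ℕ → H := fun n => s n - p with hx
  set g : ℕ → H := fun n => γ • (G (s (n + 1)) - G (s n)) with hgdef
  have hxs : ∀ n m, x n - x m = s n - s m := fun n m => sub_sub_sub_cancel_right _ _ _
  have hg : ∀ n, ‖g n‖ ≤ κ * ‖x (n + 1) - x n‖ := fun n => by
    rw [hxs, hgdef, norm_smul, Real.norm_of_nonneg hγ.le, hκdef, mul_assoc]
    refine mul_le_mul_of_nonneg_left ?_ hγ.le
    simpa [dist_eq_norm] using hGL.dist_le_mul (s (n + 1)) (s n)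
  set l : ℕ → ℝ := fun n => lam (n + 1) with hldef
  have hllim : Tendsto l atTop (𝓝 0) := (tendsto_add_atTop_iff_nat 1).2 hlim
  set q : H := w - p with hq
  choose e heM hγe using hs.exists_mem_opAdd
  have hγe' : ∀ n, γ • e n = l n • q
      + (1 - l n) • (x (n + 2) + θ₁ • (x (n + 2) - x (n + 1)) + θ₂ • (x (n + 1) - x n))
      - x (n + 3) + g (n + 2) - (1 - l n) • g (n + 1) := fun n => by
    simp only [hγe, hldef, hq, hx, hgdef]
    module
  set W : ℕ → ℝ := fun n => lyapunov θ₁ θ₂ A B (x (n + 2)) (x (n + 1)) (x n) (g (n + 1)) with hWdef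
  set S : ℕ → ℝ := fun n =>
    ‖x (n + 3) - x (n + 2)‖ ^ 2 + ‖x (n + 2) - x (n + 1)‖ ^ 2 + ‖x (n + 1) - x n‖ ^ 2 with hSdef
  have hWx : ∀ n, ‖x (n + 2)‖ ^ 2 / 3 ≤ W n := fun n =>
    lyapunov_ge hθ₁ hκ (by linarith) hθ₂ (by linarith) (by linarith) (hg (n + 1))
  have hstep : ∀ᶠ n in atTop, W (n + 1) ≤ (1 - l n) * W n
      + l n * (2 * inner ℝ q (x (n + 3)) - ‖x (n + 3)‖ ^ 2 / 3) - ε / 2 * S n := by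
    filter_upwards [hllim.eventually_lt_const (show 0 < ε / 6 by positivity)] with n hn
    refine lyapunov_step hθ₁ hκ hθ₂ hε0 hε hA hB (hlam n).1.le (by linarith) (hg (n + 1)) ?_
    rw [← hγe' n, inner_smul_right]
    have h1 := hM _ _ _ _ (heM n) hp
    rw [zero_mul, sub_zero] at h1
    exact mul_nonneg hγ.le h1
  obtain ⟨R, hR0, hR⟩ : ∃ R, 0 ≤ R ∧ ∀ᶠ n in atTop, ‖x n‖ ≤ R := by
    obtain ⟨N, hN⟩ := eventually_atTop.1 hstep
    -- `3‖q‖²` bounds `2⟪q, x⟫ - ‖x‖² / 3` for all `x`, so each new `W` is at most a convex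
    -- combination of numbers below `C`.
    set C := max (W N) (3 * ‖q‖ ^ 2) with hC
    have hWC : ∀ n, N ≤ n → W n ≤ C := by
      intro n hn
      induction n, hn using Nat.le_induction with
      | base => exact le_max_left _ _
      | succ n hn ih =>
        have h1 := hN n hn
        have h2 : 2 * inner ℝ q (x (n + 3)) - ‖x (n + 3)‖ ^ 2 / 3 ≤ C := by
          refine le_trans ?_ (le_max_right _ _)
          have := real_inner_le_norm q (x (n + 3))
          nlinarith [sq_nonneg (3 * ‖q‖ - ‖x (n + 3)‖)]
        have h3 := mul_le_mul_of_nonneg_left h2 (hlam n).1.le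
        have h4 := mul_le_mul_of_nonneg_left ih (sub_nonneg.2 (hlam n).2.le)
        have h5 : 0 ≤ ε / 2 * S n := by positivity
        simp only [hldef] at h1
        linarith
    refine ⟨√(3 * C), Real.sqrt_nonneg _, ?_⟩
    filter_upwards [eventually_ge_atTop (N + 2)] with n hn
    obtain ⟨m, rfl⟩ := Nat.exists_eq_add_of_le' (le_of_add_le_right hn)
    refine Real.le_sqrt_of_sq_le ?_
    linarith [hWx m, hWC m (by omega)]
  have hRk : ∀ k, ∀ᶠ n in atTop, ‖x (n + k)‖ ≤ R := fun k =>
    (tendsto_add_atTop_nat k).eventually hR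
  have hW0 : Tendsto W atTop (𝓝 0) := by
    refine tendsto_zero_of_eventually_le (fun n => le_trans (by positivity) (hWx n))
      (fun n => (hlam n).2) hsum fun δ hδ => ?_
    obtain ⟨η, hη0, hη⟩ := exists_inner_le_of_norm_le hM ht hz hzp hR0 (half_pos hδ)
    -- Then `4σ` is half of `γ η`; the other half is left for the anchoring term in `norm_step_le`.
    set σ : ℝ := γ * η / 8 with hσ
    have hσ0 : 0 < σ := by positivity
    have hl1 : ∀ᶠ n in atTop, l n * (‖q‖ + 5 * R) < γ * η / 2 := by
      have := hllim.mul_const (‖q‖ + 5 * R)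
      rw [zero_mul] at this
      exact this.eventually_lt_const (by positivity)
    have hl2 : ∀ᶠ n in atTop, l n * (2 * (‖q‖ * R)) < ε / 2 * σ ^ 2 := by
      have := hllim.mul_const (2 * (‖q‖ * R))
      rw [zero_mul] at this
      exact this.eventually_lt_const (by positivity)
    filter_upwards [hstep, hl1, hl2, hR, hRk 1, hRk 2, hRk 3] with n h1 h2 h3 r0 r1 r2 r3
    obtain ⟨hln0, hln1⟩ : 0 < l n ∧ l n < 1 := hlam n
    have h4 : 0 ≤ l n * (‖x (n + 3)‖ ^ 2 / 3) := by positivity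
    -- Small increments make the residual small, so the approximate variational inequality applies.
    -- Large ones let the dissipation `(ε/2) S n` outweigh the anchoring term, which tends to zero.
    rcases le_or_gt (S n) (σ ^ 2) with hS | hS
    · have d3 : ‖x (n + 3) - x (n + 2)‖ ≤ σ := le_of_sq_le_sq (by
        linarith [sq_nonneg ‖x (n + 2) - x (n + 1)‖, sq_nonneg ‖x (n + 1) - x n‖]) hσ0.le
      have d2 : ‖x (n + 2) - x (n + 1)‖ ≤ σ := le_of_sq_le_sq (by
        linarith [sq_nonneg ‖x (n + 3) - x (n + 2)‖, sq_nonneg ‖x (n + 1) - x n‖]) hσ0.le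
      have d1 : ‖x (n + 1) - x n‖ ≤ σ := le_of_sq_le_sq (by
        linarith [sq_nonneg ‖x (n + 2) - x (n + 1)‖, sq_nonneg ‖x (n + 3) - x (n + 2)‖]) hσ0.le
      have he : ‖e n‖ ≤ η := by
        have h5 := norm_step_le (q := q) hθ₁ hκ hθ₂ (by linarith) hln0.le hln1.le r0 r1 r2 d3 d2 d1
          (hg (n + 2)) (hg (n + 1))
        rw [← hγe' n, norm_smul, Real.norm_of_nonneg hγ.le] at h5
        refine le_of_mul_le_mul_left ?_ hγ
        linarith
      have h5 := hη _ _ (heM n) r3 he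
      have h6 : l n * (2 * inner ℝ q (x (n + 3))) ≤ l n * δ :=
        mul_le_mul_of_nonneg_left (by linarith) hln0.le
      have h7 : 0 ≤ ε / 2 * S n := by positivity
      linarith
    · have h5 : inner ℝ q (x (n + 3)) ≤ ‖q‖ * R :=
        (real_inner_le_norm _ _).trans (mul_le_mul_of_nonneg_left r3 (norm_nonneg _))
      have h6 : l n * (2 * inner ℝ q (x (n + 3))) ≤ l n * (2 * (‖q‖ * R)) :=
        mul_le_mul_of_nonneg_left (by linarith) hln0.le
      have h7 : ε / 2 * σ ^ 2 ≤ ε / 2 * S n := mul_le_mul_of_nonneg_left hS.le (by positivity)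
      have h8 : 0 ≤ l n * δ := by positivity
      linarith
  have hx0 : Tendsto (fun n => ‖x (n + 2)‖) atTop (𝓝 0) := by
    have h1 : Tendsto (fun n => √(3 * W n)) atTop (𝓝 √(3 * 0)) :=
      (hW0.const_mul 3).sqrt
    rw [mul_zero, Real.sqrt_zero] at h1
    refine squeeze_zero (fun n => norm_nonneg _) (fun n => Real.le_sqrt_of_sq_le ?_) h1
    linarith [hWx n]
  exact tendsto_iff_norm_sub_tendsto_zero.2 ((tendsto_add_atTop_iff_nat 2).1 hx0)

end FRAB

theorem mainTheorem1 {H : Type*} [NormedAddCommGroup H] [InnerProductSpace ℝ H] [CompleteSpace H]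
    (F : H → Set H) (G : H → H) (μF μG : ℝ) (L : ℝ≥0) (γ θ₁ θ₂ : ℝ) (lam : ℕ → ℝ)
    (hF : FRAB.IsMaxMonotone μF F)
    (hG : FRAB.IsMonotone μG (FRAB.single G))
    (hL : 0 < L) (hGL : LipschitzWith L G)
    (hμ : 0 ≤ μF + μG)
    (hzer : (FRAB.zer (FRAB.opAdd F G)).Nonempty)
    (hγ : 0 < γ) (hγL : γ < 1 / (2 * (L : ℝ)))
    (hθ₁ : 0 ≤ θ₁) (hθ₁' : θ₁ < 1 / 3 * (1 - 2 * γ * (L : ℝ)))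
    (hθ₂ : 1 / (3 + 4 * θ₁) * (3 * θ₁ - 1 + 2 * γ * (L : ℝ)) < θ₂) (hθ₂' : θ₂ ≤ 0)
    (hγμ : 0 < 1 + γ * μF)
    (hlam : ∀ k : ℕ, 1 ≤ k → 0 < lam k ∧ lam k < 1)
    (hlam_lim : Tendsto lam atTop (𝓝 0))
    (hlam_sum : Tendsto (fun n : ℕ => ∑ k ∈ Finset.Icc 1 n, lam k) atTop atTop)
    (w a b c : H) :
    (∃! s : ℕ → H, FRAB.IsGenerated F G γ θ₁ θ₂ lam w a b c s) ∧
    ∃ p : H, FRAB.IsMetricProjection (FRAB.zer (FRAB.opAdd F G)) w p ∧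
      ∀ s : ℕ → H, FRAB.IsGenerated F G γ θ₁ θ₂ lam w a b c s → Tendsto s atTop (𝓝 p) := by
  refine ⟨FRAB.existsUnique_isGenerated hF hγ hγμ G θ₁ θ₂ lam w a b c, ?_⟩
  obtain ⟨r, hr, hres⟩ := FRAB.exists_resolvent_opAdd_nonempty hF hGL
  obtain ⟨p, hp, hvar, t, z, ht, hz, hzp⟩ :=
    FRAB.exists_projection_and_curve ((hF.1.opAdd hG).mono hμ) hr hres hzer w
  refine ⟨p, FRAB.isMetricProjection_of_inner_nonpos hp hvar, fun s hs => ?_⟩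
  -- Since `θ₁ θ₂ ≤ 0`, the factor `3 + 4θ₁` in the lower bound on `θ₂` may be weakened to `3`.
  have hθ : 0 < 1 - 3 * θ₁ - 2 * (γ * L) + 3 * θ₂ := by
    rw [one_div_mul_eq_div, div_lt_iff₀ (by linarith)] at hθ₂
    have := mul_nonneg hθ₁ (neg_nonneg.2 hθ₂')
    linarith
  refine hs.tendsto hF.1 hG hGL hμ hγ hθ₁ hθ₂' hθ (fun n => hlam (n + 1) (by omega)) hlam_lim ?_
    hp ht hz hzp
  convert hlam_sum using 2 with n
  rw [Finset.range_eq_Ico, Finset.sum_Ico_add' lam 0 n 1]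
  rfl
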